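/- For each $k\ge 1$ let $a_k\in\{0,1\}$, and write $\mathbf a=(a_k)_{k\ge1}$. For $n\ge 0$ and $\mathbb R[x_1,\dots,x_n]$ with $\partial_i=\partial/\partial x_i$, put $$\widetilde D_k=\sum_{i=1}^n x_i\,\partial_i^{k+1},\qquad \widehat D_k=\sum_{i=1}^n \partial_i^{k+1}x_i\qquad(k\ge 1),$$ where in $\widehat D_k$ one first multiplies by $x_i$ and then differentiates. Let $$\widetilde{\mathcal H}_n^{\mathbf a}=\{f\in\mathbb R[x_1,\dots,x_n]: a_k\widetilde D_kf=0\ \ \forall k\ge1\},\qquad \widehat{\mathcal H}_n^{\mathbf a}=\{f\in\mathbb R[x_1,\dots,x_n]: a_k\widehat D_kf=0\ \ \forall k\ge1\}$$ be the spaces of tilde-harmonics and hat-harmonics restricted to the indices $k$ with $a_k=1$; they are graded by degree and stable under the action of the symmetric group $\mathfrak S_n$ permuting the variables. (For $n=0$ both are the scalars $\mathbb R$.) For such a graded $\mathfrak S_n$-stable space $\mathcal V=\bigoplus_{d\ge0}\mathcal V_d$, its Hilbert series is $\sum_{d\ge0}t^d\dim\mathcal V_d$ and its graded Frobenius characteristic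 is $$\sum_{d\ge0}t^d\,\frac1{n!}\sum_{\sigma\in\mathfrak S_n}\chi^{\mathcal V_d}(\sigma)\,p_{\lambda(\sigma)},$$ a power series in $t$ with coefficients in the ring of symmetric functions over $\mathbb R$, where $\chi^{\mathcal V_d}$ is the character of $\mathcal V_d$, $\lambda(\sigma)$ is the cycle type of $\sigma$ and $p_\lambda$ is the power sum symmetric function. Let $\widetilde F_n^{\mathbf a}(t)$, $\widehat F_n^{\mathbf a}(t)$ be the graded Frobenius characteristics, and $\widetilde{\mathcal H}_n^{\mathbf a}(t)$, $\widehat{\mathcal H}_n^{\mathbf a}(t)$ the Hilbert series, of $\widetilde{\mathcal H}_n^{\mathbf a}$ and $\widehat{\mathcal H}_n^{\mathbf a}$. Let $h_m$ be the complete homogeneous symmetric function of degree $m$. Then, for every choice of $\mathbf a$ and every $n\ge0$, $$\widetilde F_n^{\mathbf a}(t)=\sum_{k=0}^n t^k\,\widehat F_k^{\mathbf a}(t)\,h_{n-k}\qquad\text{and}\qquad \widetilde{\mathcal H}_n^{\mathbf a}(t)=\sum_{k=0}^n\binom nk\,t^k\,\widehat{\mathcal H}_k^{\mathbf a}(t).$$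 -/

import Mathlib

noncomputable section

namespace SteenrodHarmonics

open MvPolynomial

/-! ### The ring of symmetric functions with real coefficients -/

/-- The ring `Λ` of symmetric functions over `ℝ` in countably many variables: formal power series
of bounded degree that are invariant under all permutations of the variables. -/
def SymFun : Subalgebra ℝ (MvPowerSeries ℕ ℝ) where
  carrier := {f | (∀ σ : Equiv.Perm ℕ, MvPowerSeries.rename σ f = f) ∧
    ∃ N : ℕ, ∀ d : ℕ →₀ ℕ, N < d.degree → MvPowerSeries.coeff d f = 0}
  mul_mem' := by
    rintro f g ⟨hf, N, hN⟩ ⟨hg, M, hM⟩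
    refine ⟨fun σ => by rw [map_mul, hf, hg], N + M, fun d hd => ?_⟩
    rw [MvPowerSeries.coeff_mul]
    refine Finset.sum_eq_zero fun p hp => ?_
    have hp' : p.1 + p.2 = d := Finset.HasAntidiagonal.mem_antidiagonal.mp hp
    have hdeg : p.1.degree + p.2.degree = d.degree := by rw [← hp', map_add]
    by_cases h : N < p.1.degree
    · rw [hN _ h, zero_mul]
    · rw [hM _ (by omega), mul_zero]
  add_mem' := by
    rintro f g ⟨hf, N, hN⟩ ⟨hg, M, hM⟩
    refine ⟨fun σ => by rw [map_add, hf, hg], N + M, fun d hd => ?_⟩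
    rw [map_add, hN _ (by omega), hM _ (by omega), add_zero]
  algebraMap_mem' := by
    intro r
    refine ⟨fun σ => AlgHom.commutes _ r, 0, fun d hd => ?_⟩
    rw [MvPowerSeries.algebraMap_apply, MvPowerSeries.coeff_C, if_neg]
    · rintro rfl
      simp at hd

/-- A power series whose coefficients do not change when the exponents are permuted is fixed by
every permutation of the variables. -/
theorem rename_eq_self_of_coeff {f : MvPowerSeries ℕ ℝ} (σ : Equiv.Perm ℕ)
    (h : ∀ d : ℕ →₀ ℕ, MvPowerSeries.coeff (d.embDomain σ.toEmbedding) f =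
      MvPowerSeries.coeff d f) :
    MvPowerSeries.rename σ f = f := by
  ext e
  obtain ⟨d, rfl⟩ : ∃ d : ℕ →₀ ℕ, d.embDomain σ.toEmbedding = e := by
    refine ⟨e.embDomain σ.symm.toEmbedding, ?_⟩
    ext i
    have h1 := Finsupp.embDomain_apply_self σ.toEmbedding
      (e.embDomain σ.symm.toEmbedding) (σ.symm i)
    have h2 := Finsupp.embDomain_apply_self σ.symm.toEmbedding e i
    simp only [Equiv.coe_toEmbedding, Equiv.apply_symm_apply] at h1 h2
    rw [h1, h2]
  rw [h d]
  exact MvPowerSeries.coeff_embDomain_rename σ.toEmbedding f d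

/-- The degree of an exponent vector does not change under a permutation. -/
theorem degree_embDomain (σ : Equiv.Perm ℕ) (d : ℕ →₀ ℕ) :
    (d.embDomain σ.toEmbedding).degree = d.degree := by
  rw [Finsupp.embDomain_eq_mapDomain]
  exact Finsupp.degree_mapDomain _ _

/-- The complete homogeneous symmetric function `h_r`: the sum of all monomials of degree `r`. -/
def completeSym (r : ℕ) : SymFun :=
  ⟨fun d => if d.degree = r then 1 else 0, by
    refine ⟨fun σ => rename_eq_self_of_coeff σ fun d => ?_, r, fun d hd => ?_⟩
    · change (if (d.embDomain σ.toEmbedding).degree = r then (1 : ℝ) else 0) =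
        if d.degree = r then 1 else 0
      rw [degree_embDomain]
    · exact if_neg (by omega)⟩

open Classical in
/-- The power sum symmetric function `p_r = ∑ i, z_i ^ r` (for `r ≥ 1`): the sum of all monomials
`z_i ^ r`. -/
def powerSum (r : ℕ) : SymFun :=
  ⟨fun d => if ∃ i, d = Finsupp.single i r then 1 else 0, by
    refine ⟨fun σ => rename_eq_self_of_coeff σ fun d => ?_, r, fun d hd => ?_⟩
    · change (if ∃ i, d.embDomain σ.toEmbedding = Finsupp.single i r then (1 : ℝ) else 0) =
        if ∃ i, d = Finsupp.single i r then 1 else 0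
      refine if_congr ⟨?_, ?_⟩ rfl rfl
      · rintro ⟨i, hi⟩
        refine ⟨σ.symm i, Finsupp.embDomain_injective σ.toEmbedding ?_⟩
        rw [hi, Finsupp.embDomain_single]
        simp
      · rintro ⟨i, rfl⟩
        exact ⟨σ i, by rw [Finsupp.embDomain_single]; rfl⟩
    · refine if_neg ?_
      rintro ⟨i, rfl⟩
      simp at hd⟩

/-- `p_{λ(σ)}`, the product of the power sums `p_r` over the lengths `r` of the cycles of `σ`
(fixed points included). -/
def cyclePowerSum {n : ℕ} (σ : Equiv.Perm (Fin n)) : SymFun :=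
  (σ.partition.parts.map powerSum).prod

/-! ### Graded Hilbert series and Frobenius characteristics -/

/-- The symmetric group acting on `ℝ[x_1, …, x_n]` by permutation of the variables. -/
def permRep (n : ℕ) : Representation ℝ (Equiv.Perm (Fin n)) (MvPolynomial (Fin n) ℝ) where
  toFun σ := (rename σ).toLinearMap
  map_one' := by
    refine LinearMap.ext fun f => ?_
    simp [Equiv.Perm.coe_one]
  map_mul' σ τ := by
    refine LinearMap.ext fun f => ?_
    simp [rename_rename, Equiv.Perm.coe_mul]

/-- The homogeneous polynomials of degree `d`, as a subrepresentation. -/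
def homogRep (n d : ℕ) : Subrepresentation (permRep n) where
  toSubmodule := homogeneousSubmodule (Fin n) ℝ d
  apply_mem_toSubmodule σ f hf := by
    rw [mem_homogeneousSubmodule] at hf ⊢
    exact hf.rename_isHomogeneous

/-- The homogeneous component of degree `d` of an invariant space of polynomials. -/
def gradedPiece {n : ℕ} (V : Subrepresentation (permRep n)) (d : ℕ) :
    Subrepresentation (permRep n) :=
  V ⊓ homogRep n d

/-- The Hilbert series `∑ d, dim(V_d) t^d`. -/
def hilbertSeries {n : ℕ} (V : Subrepresentation (permRep n)) : PowerSeries ℤ :=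
  PowerSeries.mk fun d => (Module.finrank ℝ (gradedPiece V d).toSubmodule : ℤ)

/-- The graded Frobenius characteristic
`∑ d, t^d (1 / n!) ∑ σ, χ^{V_d}(σ) p_{λ(σ)}`, a power series in `t` over the symmetric
functions. -/
def frobeniusChar {n : ℕ} (V : Subrepresentation (permRep n)) : PowerSeries SymFun :=
  PowerSeries.mk fun d =>
    ((n.factorial : ℝ)⁻¹) • ∑ σ : Equiv.Perm (Fin n),
      (gradedPiece V d).toRepresentation.character σ • cyclePowerSum σ

/-! ### Tilde-harmonics and hat-harmonics -/

/-- The operator `∂_i ^ m` on `ℝ[x_1, …, x_n]`. -/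
def partialPow {n : ℕ} (i : Fin n) (m : ℕ) :
    MvPolynomial (Fin n) ℝ →ₗ[ℝ] MvPolynomial (Fin n) ℝ :=
  (pderiv i : Derivation ℝ (MvPolynomial (Fin n) ℝ) (MvPolynomial (Fin n) ℝ)).toLinearMap ^ m

/-- `D̃_k = ∑ i, x_i ∂_i ^ (k + 1)`. -/
def tildeOp (n k : ℕ) : MvPolynomial (Fin n) ℝ →ₗ[ℝ] MvPolynomial (Fin n) ℝ :=
  ∑ i : Fin n, LinearMap.mulLeft ℝ (X i) ∘ₗ partialPow i (k + 1)

/-- `D̂_k = ∑ i, ∂_i ^ (k + 1) x_i`, that is: multiply by `x_i`, then differentiate. -/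
def hatOp (n k : ℕ) : MvPolynomial (Fin n) ℝ →ₗ[ℝ] MvPolynomial (Fin n) ℝ :=
  ∑ i : Fin n, partialPow i (k + 1) ∘ₗ LinearMap.mulLeft ℝ (X i)

/-- `∂_{σ i} ^ m` applied to the permuted polynomial. -/
theorem partialPow_rename {n : ℕ} (σ : Equiv.Perm (Fin n)) (i : Fin n) (m : ℕ)
    (f : MvPolynomial (Fin n) ℝ) :
    partialPow (σ i) m (rename σ f) = rename σ (partialPow i m f) := by
  induction m generalizing f with
  | zero => simp [partialPow]
  | succ m ih =>
    have h : ∀ (j : Fin n) (g : MvPolynomial (Fin n) ℝ),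
        partialPow j (m + 1) g = partialPow j m (pderiv j g) := by
      intro j g
      simp [partialPow, pow_succ]
    rw [h, h, pderiv_rename σ.injective, ih]

/-- `D̃_k` commutes with permutations of the variables. -/
theorem tildeOp_rename {n : ℕ} (k : ℕ) (σ : Equiv.Perm (Fin n)) (f : MvPolynomial (Fin n) ℝ) :
    tildeOp n k (rename σ f) = rename σ (tildeOp n k f) := by
  simp only [tildeOp, LinearMap.sum_apply, LinearMap.comp_apply, LinearMap.mulLeft_apply,
    map_sum, map_mul, rename_X]
  rw [← Equiv.sum_comp σ]
  simp only [partialPow_rename]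

/-- `D̂_k` commutes with permutations of the variables. -/
theorem hatOp_rename {n : ℕ} (k : ℕ) (σ : Equiv.Perm (Fin n)) (f : MvPolynomial (Fin n) ℝ) :
    hatOp n k (rename σ f) = rename σ (hatOp n k f) := by
  simp only [hatOp, LinearMap.sum_apply, LinearMap.comp_apply, LinearMap.mulLeft_apply, map_sum]
  rw [← Equiv.sum_comp σ]
  refine Finset.sum_congr rfl fun i _ => ?_
  rw [← partialPow_rename, map_mul (rename σ), rename_X]

/-- The space of tilde-harmonics in `n` variables for the equations `a_k D̃_k f = 0`, `k ≥ 1`. -/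
def tildeHarmonics (a : ℕ → ℝ) (n : ℕ) : Subrepresentation (permRep n) where
  toSubmodule :=
    { carrier := {f | ∀ k : ℕ, 1 ≤ k → a k • tildeOp n k f = 0}
      add_mem' := fun {f g} hf hg k hk => by rw [map_add, smul_add, hf k hk, hg k hk, add_zero]
      zero_mem' := fun k _ => by rw [map_zero, smul_zero]
      smul_mem' := fun c f hf k hk => by rw [map_smul, smul_comm, hf k hk, smul_zero] }
  apply_mem_toSubmodule σ f hf k hk := by
    change a k • tildeOp n k (rename σ f) = 0
    rw [tildeOp_rename, ← map_smul, hf k hk, map_zero]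

/-- The space of hat-harmonics in `n` variables for the equations `a_k D̂_k f = 0`, `k ≥ 1`. -/
def hatHarmonics (a : ℕ → ℝ) (n : ℕ) : Subrepresentation (permRep n) where
  toSubmodule :=
    { carrier := {f | ∀ k : ℕ, 1 ≤ k → a k • hatOp n k f = 0}
      add_mem' := fun {f g} hf hg k hk => by rw [map_add, smul_add, hf k hk, hg k hk, add_zero]
      zero_mem' := fun k _ => by rw [map_zero, smul_zero]
      smul_mem' := fun c f hf k hk => by rw [map_smul, smul_comm, hf k hk, smul_zero] }
  apply_mem_toSubmodule σ f hf k hk := by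
    change a k • hatOp n k (rename σ f) = 0
    rw [hatOp_rename, ← map_smul, hf k hk, map_zero]

end SteenrodHarmonics

end

noncomputable section

namespace SteenrodHarmonics

open MvPolynomial

/-! ### Cycle types of permutations of a disjoint union -/

section CycleType

/-! Group the monomials of a polynomial by their support `S`. This splits the polynomial ring into
the spaces `x_S · ℝ[x_i : i ∈ S]`, where `x_S` is the product of the `x_i` with `i ∈ S`. On such a
space `∂_j` vanishes for `j ∉ S`, and for `i ∈ S` the factor `x_i` of `x_S` slips under the
derivative, so `D̃_m (x_S f) = x_S (D̂_m f)` (`tildeOp_supportEmb`). Each summand is therefore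
stable under all `D̃_m`, and the tilde-harmonics are the direct sum over `S` of copies of the
hat-harmonics in `|S|` variables, shifted by `|S|` in degree. Counting subsets of size `k` gives the
Hilbert series.

A permutation `σ` carries the `S`-summand to the `σ(S)`-summand, so only the `S` stable under `σ`
contribute to its trace. The `σ` stabilizing `S` are the pairs `(τ, ρ)` in `𝔖_k × 𝔖_{n-k}`; the
trace depends on `τ` alone, and `p_{λ(σ)} = p_{λ(τ)} p_{λ(ρ)}` (`sum_supportTrace_smul`). The sum
over `ρ` is `(n-k)! h_{n-k}` (`completeSym_eq_sum`), by Burnside's lemma: the coefficients of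
`p_{λ(ρ)}` count the colorings fixed by `ρ`, and colorings of given content form one orbit. Finally
`C(n,k) / n! = 1 / (k! (n-k)!)`. -/

theorem permCongr_sumCongr_eq_mul {α β γ : Type*} [Fintype α] [Fintype β] [DecidableEq γ] (E : α ⊕ β ≃ γ) (τ : Equiv.Perm α) (ρ : Equiv.Perm β) :
    E.permCongr (Equiv.sumCongr τ ρ) =
      τ.extendDomain (Equiv.ofInjective (E ∘ Sum.inl) (E.injective.comp Sum.inl_injective)) *
      ρ.extendDomain (Equiv.ofInjective (E ∘ Sum.inr) (E.injective.comp Sum.inr_injective)) := by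
  ext x
  obtain ⟨y, rfl⟩ := E.surjective x
  rcases y with a | b
  · rw [Equiv.Perm.mul_apply, Equiv.Perm.extendDomain_apply_not_subtype ρ _ (by simp)]
    have := Equiv.Perm.extendDomain_apply_image τ
      (Equiv.ofInjective (E ∘ Sum.inl) (E.injective.comp Sum.inl_injective)) a
    simp only [Equiv.ofInjective_apply, Function.comp_apply] at this
    simp [this]
  · have := Equiv.Perm.extendDomain_apply_image ρ
      (Equiv.ofInjective (E ∘ Sum.inr) (E.injective.comp Sum.inr_injective)) b
    simp only [Equiv.ofInjective_apply, Function.comp_apply] at this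
    rw [Equiv.Perm.mul_apply, this, Equiv.Perm.extendDomain_apply_not_subtype τ _ (by simp)]
    simp

variable {α β γ : Type*} [Fintype α] [DecidableEq α] [Fintype β] [DecidableEq β]
  [Fintype γ] [DecidableEq γ]

theorem cycleType_permCongr_sumCongr (E : α ⊕ β ≃ γ) (τ : Equiv.Perm α) (ρ : Equiv.Perm β) :
    (E.permCongr (Equiv.sumCongr τ ρ)).cycleType = τ.cycleType + ρ.cycleType := by
  rw [permCongr_sumCongr_eq_mul, Equiv.Perm.Disjoint.cycleType_mul,
    Equiv.Perm.cycleType_extendDomain, Equiv.Perm.cycleType_extendDomain]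
  intro x
  obtain ⟨y, rfl⟩ := E.surjective x
  rcases y with a | b
  · exact Or.inr (Equiv.Perm.extendDomain_apply_not_subtype ρ _ (by simp))
  · exact Or.inl (Equiv.Perm.extendDomain_apply_not_subtype τ _ (by simp))

theorem parts_partition_permCongr_sumCongr (E : α ⊕ β ≃ γ) (τ : Equiv.Perm α)
    (ρ : Equiv.Perm β) :
    (E.permCongr (Equiv.sumCongr τ ρ)).partition.parts =
      τ.partition.parts + ρ.partition.parts := by
  have h := cycleType_permCongr_sumCongr E τ ρ
  have hs := congrArg Multiset.sum h
  rw [Multiset.sum_add, Equiv.Perm.sum_cycleType, Equiv.Perm.sum_cycleType,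
    Equiv.Perm.sum_cycleType] at hs
  have hc := Fintype.card_congr E
  rw [Fintype.card_sum] at hc
  -- The parts are the cycle type padded with a `1` for each fixed point; these bounds make the
  -- truncated subtractions counting fixed points additive.
  have h1 := τ.support.card_le_univ
  have h2 := ρ.support.card_le_univ
  rw [Equiv.Perm.parts_partition, Equiv.Perm.parts_partition, Equiv.Perm.parts_partition, h, hs,
    ← hc, show Fintype.card α + Fintype.card β - (τ.support.card + ρ.support.card) =
      (Fintype.card α - τ.support.card) + (Fintype.card β - ρ.support.card) by omega,
    Multiset.replicate_add]
  exact add_add_add_comm _ _ _ _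

theorem parts_partition_of_isCycleOn_univ [Nonempty α] {σ : Equiv.Perm α}
    (h : σ.IsCycleOn Set.univ) : σ.partition.parts = {Fintype.card α} := by
  -- On one point `σ = 1` is not a cycle in the sense of `IsCycle`, and its part `1` comes from the
  -- padding by fixed points.
  rcases subsingleton_or_nontrivial α with hα | hα
  · have hσ : σ = 1 := Subsingleton.elim _ _
    have hc : Fintype.card α = 1 := Fintype.card_eq_one_iff_nonempty_unique.mpr
      ⟨⟨⟨Classical.arbitrary α⟩, fun a => Subsingleton.elim _ _⟩⟩
    rw [Equiv.Perm.parts_partition, hσ, Equiv.Perm.cycleType_one, Equiv.Perm.support_one, hc]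
    simp
  · have hsupp : σ.support = Finset.univ := by
      ext a
      simpa using h.apply_ne Set.nontrivial_univ (Set.mem_univ a)
    have hcyc : σ.IsCycle := by
      obtain ⟨a⟩ := hα.to_nonempty
      exact ⟨a, h.apply_ne Set.nontrivial_univ (Set.mem_univ a),
        fun b _ => h.2 (Set.mem_univ a) (Set.mem_univ b)⟩
    rw [Equiv.Perm.parts_partition, hcyc.cycleType, hsupp]
    simp

end CycleType

/-! ### Power sums as generating functions of invariant colorings -/

section Coloring

variable {α β γ : Type*} [Fintype α] [Fintype β] [Fintype γ]

/-- The exponent vector recording how often each color is used. -/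
def content (f : α → ℕ) : ℕ →₀ ℕ := ∑ a, Finsupp.single (f a) 1

theorem content_apply (f : α → ℕ) (i : ℕ) : content f i = Nat.card {a // f a = i} := by
  classical
  rw [Nat.card_eq_fintype_card, Fintype.card_subtype, content, Finsupp.finsetSum_apply,
    Finset.card_filter]
  exact Finset.sum_congr rfl fun a _ => Finsupp.single_apply

theorem content_comp_equiv (f : β → ℕ) (e : α ≃ β) : content (f ∘ e) = content f :=
  Equiv.sum_comp e fun b => Finsupp.single (f b) 1

theorem content_sum (f : α ⊕ β → ℕ) :
    content f = content (f ∘ Sum.inl) + content (f ∘ Sum.inr) :=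
  Fintype.sum_sum_type _

theorem degree_content (f : α → ℕ) : (content f).degree = Fintype.card α := by
  simp [content, map_sum]

/-- Equal contents mean that color classes of the same color are equinumerous; bijections between
them glue to a permutation. -/
theorem exists_perm_of_content_eq {f g : α → ℕ} (h : content f = content g) :
    ∃ σ : Equiv.Perm α, g ∘ σ = f := by
  have e : ∀ c, Nonempty ({a // f a = c} ≃ {a // g a = c}) := fun c => by
    rw [← Finite.card_eq, ← content_apply, ← content_apply, h]
  exact ⟨Equiv.ofFiberEquiv fun c => (e c).some, funext fun a => Equiv.ofFiberEquiv_map _ a⟩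

/-- Take `d i` points of each color `i` and identify their disjoint union with `α`. -/
theorem exists_content_eq {d : ℕ →₀ ℕ} (h : d.degree = Fintype.card α) :
    ∃ f : α → ℕ, content f = d := by
  have hc : Fintype.card (Σ i : d.support, Fin (d i)) = Fintype.card α := by
    rw [Fintype.card_sigma, ← h, Finsupp.degree_apply]
    simp only [Fintype.card_fin]
    exact Finset.sum_coe_sort d.support d
  let e := (Fintype.equivOfCardEq hc).symm
  refine ⟨(fun x : Σ i : d.support, Fin (d i) => (x.1 : ℕ)) ∘ e, ?_⟩
  rw [content_comp_equiv, content, Fintype.sum_sigma]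
  simp only [Finset.sum_const, Finset.card_univ, Fintype.card_fin, Finsupp.smul_single,
    smul_eq_mul, mul_one]
  rw [Finset.sum_coe_sort d.support fun i => Finsupp.single i (d i)]
  exact d.sum_single

/-- The colorings with content `d` that are constant on the cycles of `σ`. -/
abbrev InvariantColoring (σ : Equiv.Perm α) (d : ℕ →₀ ℕ) : Type _ :=
  {f : α → ℕ // f ∘ σ = f ∧ content f = d}

theorem mem_support_of_content_eq {f : α → ℕ} {d : ℕ →₀ ℕ} (h : content f = d) (a : α) :
    f a ∈ d.support := by
  rw [Finsupp.mem_support_iff, ← h, content_apply]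
  have : Nonempty {b // f b = f a} := ⟨⟨a, rfl⟩⟩
  exact Nat.card_pos.ne'

/-- All colors lie in the finite set `d.support`. Without finiteness `Nat.card` would be the default
`0`. -/
instance finite_coloring (d : ℕ →₀ ℕ) : Finite {f : α → ℕ // content f = d} := by
  refine Finite.of_injective
    (fun f a => (⟨f.1 a, mem_support_of_content_eq f.2 a⟩ : d.support)) fun f g h => ?_
  exact Subtype.ext (funext fun a => congrArg Subtype.val (congrFun h a))

instance (σ : Equiv.Perm α) (d : ℕ →₀ ℕ) : Finite (InvariantColoring σ d) :=
  Finite.of_injective (fun f => (⟨f.1, f.2.2⟩ : {f : α → ℕ // content f = d})) fun _ _ h =>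
    Subtype.ext (Subtype.mk.inj h)

/-- An invariant coloring of a disjoint union is a pair of invariant colorings. -/
def invariantColoringSum (E : α ⊕ β ≃ γ) (τ : Equiv.Perm α) (ρ : Equiv.Perm β)
    (d : ℕ →₀ ℕ) :
    InvariantColoring (E.permCongr (Equiv.sumCongr τ ρ)) d ≃
      Σ p : Finset.HasAntidiagonal.antidiagonal d, InvariantColoring τ p.1.1 × InvariantColoring ρ p.1.2 where
  toFun f := ⟨⟨(content (f.1 ∘ E ∘ Sum.inl), content (f.1 ∘ E ∘ Sum.inr)), by
      rw [Finset.HasAntidiagonal.mem_antidiagonal]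
      exact (content_sum (f.1 ∘ E)).symm.trans ((content_comp_equiv f.1 E).trans f.2.2)⟩,
    ⟨f.1 ∘ E ∘ Sum.inl, by
      funext a
      simpa using congrFun f.2.1 (E (Sum.inl a)), rfl⟩,
    ⟨f.1 ∘ E ∘ Sum.inr, by
      funext a
      simpa using congrFun f.2.1 (E (Sum.inr a)), rfl⟩⟩
  invFun x := ⟨Sum.elim x.2.1.1 x.2.2.1 ∘ E.symm, by
      funext c
      obtain ⟨y, rfl⟩ := E.surjective c
      rcases y with a | b
      · simpa using congrFun x.2.1.2.1 a
      · simpa using congrFun x.2.2.2.1 b, by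
      rw [content_comp_equiv, content_sum, Sum.elim_comp_inl, Sum.elim_comp_inr, x.2.1.2.2,
        x.2.2.2.2]
      exact Finset.HasAntidiagonal.mem_antidiagonal.mp x.1.2⟩
  left_inv f := by
    apply Subtype.ext
    funext c
    obtain ⟨y, rfl⟩ := E.surjective c
    rcases y with a | b <;> simp
  right_inv := by
    rintro ⟨⟨⟨p, q⟩, hpq⟩, ⟨f, hf, hp⟩, ⟨g, hg, hq⟩⟩
    change content f = p at hp
    change content g = q at hq
    subst hp hq
    have h1 : (Sum.elim f g ∘ E.symm) ∘ E ∘ Sum.inl = f := by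
      funext a; simp
    have h2 : (Sum.elim f g ∘ E.symm) ∘ E ∘ Sum.inr = g := by
      funext a; simp
    -- The component types depend on the contents, so the equalities are substituted with `f'` and
    -- `g'` as free variables.
    have key : ∀ (f' : α → ℕ) (g' : β → ℕ), f' = f → g' = g →
        ∀ (hpq' : (content f', content g') ∈ Finset.HasAntidiagonal.antidiagonal d)
          (hf' : f' ∘ τ = f') (hg' : g' ∘ ρ = g'),
        (⟨⟨(content f', content g'), hpq'⟩, ⟨f', hf', rfl⟩, ⟨g', hg', rfl⟩⟩ :
          Σ p : Finset.HasAntidiagonal.antidiagonal d,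
            InvariantColoring τ p.1.1 × InvariantColoring ρ p.1.2) =
        ⟨⟨(content f, content g), hpq⟩, ⟨f, hf, rfl⟩, ⟨g, hg, rfl⟩⟩ := by
      rintro _ _ rfl rfl _ _ _
      rfl
    exact key _ _ h1 h2 (by rwa [h1, h2]) (by rw [h1, hf]) (by rw [h2, hg])

theorem card_invariantColoring_sum (E : α ⊕ β ≃ γ) (τ : Equiv.Perm α) (ρ : Equiv.Perm β)
    (d : ℕ →₀ ℕ) :
    Nat.card (InvariantColoring (E.permCongr (Equiv.sumCongr τ ρ)) d) =
      ∑ p ∈ Finset.HasAntidiagonal.antidiagonal d,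
        Nat.card (InvariantColoring τ p.1) * Nat.card (InvariantColoring ρ p.2) := by
  rw [Nat.card_congr (invariantColoringSum E τ ρ d), Nat.card_sigma]
  simp only [Nat.card_prod]
  exact Finset.sum_coe_sort (Finset.HasAntidiagonal.antidiagonal d) fun p =>
    Nat.card (InvariantColoring τ p.1) * Nat.card (InvariantColoring ρ p.2)

-- A coloring invariant under a single cycle is constant, say `i`, and contributes `z_i ^ |α|`. As
-- `|α| ≠ 0`, the exponent vector determines `i`.
open Classical in
theorem card_invariantColoring_of_isCycleOn_univ [Nonempty α] {σ : Equiv.Perm α}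
    (h : σ.IsCycleOn Set.univ) (d : ℕ →₀ ℕ) :
    Nat.card (InvariantColoring σ d) =
      if ∃ i, d = Finsupp.single i (Fintype.card α) then 1 else 0 := by
  have hconst : ∀ f : InvariantColoring σ d, ∃ i, f.1 = Function.const α i := fun f => by
    obtain ⟨a⟩ := ‹Nonempty α›
    have hσ : ∀ b, f.1 (σ b) = f.1 b := fun b => congrFun f.2.1 b
    refine ⟨f.1 a, funext fun b => ?_⟩
    obtain ⟨n, hn⟩ := (h.2 (Set.mem_univ a) (Set.mem_univ b)).exists_nat_pow_eq
    rw [← hn]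
    clear hn
    induction n with
    | zero => rfl
    | succ n ih => rw [pow_succ', Equiv.Perm.mul_apply, hσ, ih]; rfl
  have hcont : ∀ i, content (Function.const α i) = Finsupp.single i (Fintype.card α) := fun i => by
    simp [content]
  split_ifs with hd
  · obtain ⟨i, rfl⟩ := hd
    rw [Nat.card_eq_one_iff_unique]
    refine ⟨⟨fun f g => ?_⟩, ⟨⟨Function.const α i, rfl, hcont i⟩⟩⟩
    have key : ∀ f : InvariantColoring σ (Finsupp.single i (Fintype.card α)),
        f.1 = Function.const α i := fun f => by
      obtain ⟨j, hj⟩ := hconst f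
      have h2 := f.2.2
      rw [hj, hcont] at h2
      rw [hj, Finsupp.single_left_injective Fintype.card_ne_zero h2]
    exact Subtype.ext ((key f).trans (key g).symm)
  · have : IsEmpty (InvariantColoring σ d) := ⟨fun f => hd <| by
      obtain ⟨i, hi⟩ := hconst f
      exact ⟨i, by rw [← f.2.2, hi, hcont]⟩⟩
    exact Nat.card_of_isEmpty

end Coloring

theorem coeff_powerSum (r : ℕ) (d : ℕ →₀ ℕ) [Decidable (∃ i, d = Finsupp.single i r)] :
    MvPowerSeries.coeff d (powerSum r).1 = if ∃ i, d = Finsupp.single i r then 1 else 0 := by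
  change @ite ℝ _ (Classical.propDecidable _) 1 0 = _
  congr

/-- The coefficients of `p_{λ(σ)}` count the colorings constant on the cycles of `σ`. -/
theorem coeff_prod_powerSum {α : Type} [Fintype α] [DecidableEq α] (σ : Equiv.Perm α)
    (d : ℕ →₀ ℕ) :
    MvPowerSeries.coeff d ((σ.partition.parts.map powerSum).prod : SymFun).1 =
      Nat.card (InvariantColoring σ d) := by
  classical
  obtain ⟨N, hN⟩ : ∃ N, Fintype.card α = N := ⟨_, rfl⟩
  induction N using Nat.strong_induction_on generalizing α d with
  | _ N ih =>
  rcases isEmpty_or_nonempty α with hα | hα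
  · have h0 : σ.partition.parts = 0 := by
      rw [Equiv.Perm.parts_partition, Subsingleton.elim σ 1, Equiv.Perm.cycleType_one]
      simp
    rw [h0, Multiset.map_zero, Multiset.prod_zero, OneMemClass.coe_one, MvPowerSeries.coeff_one]
    split_ifs with hd
    · have : Nat.card (InvariantColoring σ d) = 1 := by
        rw [Nat.card_eq_one_iff_unique]
        exact ⟨⟨fun f g => Subtype.ext (Subsingleton.elim _ _)⟩,
          ⟨⟨isEmptyElim, Subsingleton.elim _ _, by simp [content, hd]⟩⟩⟩
      rw [this, Nat.cast_one]
    · have : IsEmpty (InvariantColoring σ d) := ⟨fun f => hd <| by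
        rw [← f.2.2, content, Finset.univ_eq_empty, Finset.sum_empty]⟩
      rw [Nat.card_of_isEmpty, Nat.cast_zero]
  -- Split off the cycle through `a` and apply induction to its complement. Both sides are
  -- convolutions over the antidiagonal of `d`: coefficients of a product on one side, pairs of
  -- invariant colorings on the other.
  · obtain ⟨a⟩ := hα
    have hinv : ∀ x, σ.SameCycle a (σ x) ↔ σ.SameCycle a x := fun x =>
      Equiv.Perm.sameCycle_apply_right
    let τ : Equiv.Perm {x // σ.SameCycle a x} := σ.subtypePerm hinv
    let ρ : Equiv.Perm {x // ¬ σ.SameCycle a x} := σ.subtypePerm fun x => not_congr (hinv x)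
    let E := Equiv.sumCompl fun x => σ.SameCycle a x
    have hσ : E.permCongr (Equiv.sumCongr τ ρ) = σ := by
      ext x
      obtain ⟨y, rfl⟩ := E.surjective x
      rcases y with y | y <;> simp [E, τ, ρ]
    have hne : Nonempty {x // σ.SameCycle a x} := ⟨⟨a, Equiv.Perm.SameCycle.refl σ a⟩⟩
    have hτ : τ.IsCycleOn Set.univ := by
      refine ⟨⟨fun _ _ => Set.mem_univ _, τ.injective.injOn, fun y _ =>
        ⟨τ.symm y, Set.mem_univ _, τ.apply_symm_apply y⟩⟩, fun x _ y _ => ?_⟩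
      exact Equiv.Perm.sameCycle_subtypePerm.mpr (x.2.symm.trans y.2)
    have hcard : Fintype.card {x // ¬ σ.SameCycle a x} < N := by
      rw [← hN]
      exact Fintype.card_subtype_lt (x := a) (not_not.mpr (Equiv.Perm.SameCycle.refl σ a))
    have hρ := fun e => ih _ hcard ρ e rfl
    rw [← hσ, card_invariantColoring_sum, parts_partition_permCongr_sumCongr, Multiset.map_add,
      Multiset.prod_add, parts_partition_of_isCycleOn_univ hτ, Multiset.map_singleton,
      Multiset.prod_singleton, MulMemClass.coe_mul, MvPowerSeries.coeff_mul, Nat.cast_sum]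
    refine Finset.sum_congr rfl fun p _ => ?_
    rw [hρ, coeff_powerSum, card_invariantColoring_of_isCycleOn_univ hτ, Nat.cast_mul]
    split_ifs <;> simp

/-- Permutations act transitively on the colorings with a given content, so their numbers of fixed
points add up to `m!`. -/
theorem sum_card_invariantColoring {α : Type*} [Fintype α] [DecidableEq α] (d : ℕ →₀ ℕ)
    (hd : d.degree = Fintype.card α) :
    ∑ σ : Equiv.Perm α, Nat.card (InvariantColoring σ d) = (Fintype.card α).factorial := by
  classical
  let X := {f : α → ℕ // content f = d}
  let _ : MulAction (Equiv.Perm α) X :=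
    { smul := fun σ f => ⟨f.1 ∘ σ.symm, by rw [content_comp_equiv, f.2]⟩
      one_smul := fun f => rfl
      mul_smul := fun σ τ f => rfl }
  have hsmul : ∀ (σ : Equiv.Perm α) (f : X), (σ • f).1 = f.1 ∘ σ.symm := fun _ _ => rfl
  have hfix : ∀ σ : Equiv.Perm α,
      Nat.card (InvariantColoring σ d) = Nat.card (MulAction.fixedBy X σ) := fun σ => by
    refine Nat.card_congr ⟨fun f => ⟨⟨f.1, f.2.2⟩, Subtype.ext ?_⟩,
      fun f => ⟨f.1.1, ?_, f.1.2⟩, fun f => rfl, fun f => rfl⟩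
    · rw [hsmul]
      exact (Equiv.comp_symm_eq σ _ _).mpr f.2.1.symm
    · have h := congrArg Subtype.val f.2
      rw [hsmul] at h
      exact ((Equiv.comp_symm_eq σ _ _).mp h).symm
  let _ := Fintype.ofFinite X
  let _ := Fintype.ofFinite (Quotient (MulAction.orbitRel (Equiv.Perm α) X))
  -- Burnside's lemma; transitivity leaves one orbit.
  have hB := MulAction.sum_card_fixedBy_eq_card_orbits_mul_card_group (Equiv.Perm α) X
  have htrans : MulAction.IsPretransitive (Equiv.Perm α) X := ⟨fun f g => by
    obtain ⟨σ, hσ⟩ := exists_perm_of_content_eq (f.2.trans g.2.symm)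
    exact ⟨σ, Subtype.ext (by rw [hsmul]; exact (Equiv.comp_symm_eq σ _ _).mpr hσ.symm)⟩⟩
  have hone : Fintype.card (Quotient (MulAction.orbitRel (Equiv.Perm α) X)) = 1 := by
    obtain ⟨f, hf⟩ := exists_content_eq hd
    rw [Fintype.card_eq_one_iff_nonempty_unique]
    exact ⟨⟨⟨Quotient.mk _ ⟨f, hf⟩⟩, fun q =>
      ((MulAction.pretransitive_iff_subsingleton_quotient _ _).mp htrans).elim _ _⟩⟩
  rw [hone, one_mul, Fintype.card_perm] at hB
  rw [← hB]
  exact Finset.sum_congr rfl fun σ _ => by rw [hfix, Nat.card_eq_fintype_card]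

/-- `h_m` is the average of `p_{λ(ρ)}` over `ρ ∈ 𝔖_m`. -/
theorem completeSym_eq_sum (m : ℕ) :
    completeSym m = ((m.factorial : ℝ)⁻¹) • ∑ ρ : Equiv.Perm (Fin m), cyclePowerSum ρ := by
  apply Subtype.ext
  ext d
  have h1 : MvPowerSeries.coeff d (completeSym m).1 = if d.degree = m then 1 else 0 := rfl
  have h2 : ∀ ρ : Equiv.Perm (Fin m), MvPowerSeries.coeff d (cyclePowerSum ρ).1 =
      Nat.card (InvariantColoring ρ d) := fun ρ => coeff_prod_powerSum ρ d
  rw [h1, SetLike.val_smul, AddSubmonoidClass.coe_finsetSum, map_smul, map_sum,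
    Finset.sum_congr rfl fun ρ _ => h2 ρ, ← Nat.cast_sum, smul_eq_mul]
  split_ifs with hd
  · rw [sum_card_invariantColoring d (by rw [hd, Fintype.card_fin]), Fintype.card_fin,
      inv_mul_cancel₀ (Nat.cast_ne_zero.mpr m.factorial_ne_zero)]
  · rw [Finset.sum_eq_zero, Nat.cast_zero, mul_zero]
    intro ρ _
    have : IsEmpty (InvariantColoring ρ d) := ⟨fun f => hd <| by
      rw [← f.2.2, degree_content, Fintype.card_fin]⟩
    exact Nat.card_of_isEmpty

theorem cyclePowerSum_permCongr_sumCongr {k m n : ℕ} (E : Fin k ⊕ Fin m ≃ Fin n)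
    (τ : Equiv.Perm (Fin k)) (ρ : Equiv.Perm (Fin m)) :
    cyclePowerSum (E.permCongr (Equiv.sumCongr τ ρ)) = cyclePowerSum τ * cyclePowerSum ρ := by
  rw [cyclePowerSum, parts_partition_permCongr_sumCongr, Multiset.map_add, Multiset.prod_add]
  rfl

/-! ### Polynomials decomposed by the supports of their monomials -/

section SupportDecomposition

variable {k l n : ℕ}

/-- The exponent vector of `x_S z^c`, where `S` is the range of `e` and `z_i = x_{e i}`. -/
def shiftExponent (e : Fin k ↪ Fin n) (c : Fin k →₀ ℕ) : Fin n →₀ ℕ :=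
  ∑ i, Finsupp.single (e i) 1 + c.mapDomain e

theorem shiftExponent_apply_self (e : Fin k ↪ Fin n) (c : Fin k →₀ ℕ) (i : Fin k) :
    shiftExponent e c (e i) = c i + 1 := by
  rw [shiftExponent, Finsupp.add_apply, Finsupp.mapDomain_apply e.injective,
    Finsupp.finsetSum_apply, Finset.sum_eq_single i, Finsupp.single_eq_same, add_comm]
  · intro j _ hj
    exact Finsupp.single_eq_of_ne (by simpa using hj.symm)
  · simp

theorem shiftExponent_apply_of_notMem (e : Fin k ↪ Fin n) (c : Fin k →₀ ℕ) {j : Fin n}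
    (hj : j ∉ Set.range e) : shiftExponent e c j = 0 := by
  rw [shiftExponent, Finsupp.add_apply, Finsupp.mapDomain_of_notMem_range _ _ hj,
    Finsupp.finsetSum_apply, add_zero]
  refine Finset.sum_eq_zero fun i _ => ?_
  exact Finsupp.single_eq_of_ne fun h => hj ⟨i, h.symm⟩

theorem support_shiftExponent (e : Fin k ↪ Fin n) (c : Fin k →₀ ℕ) :
    ((shiftExponent e c).support : Set (Fin n)) = Set.range e := by
  ext j
  simp only [Finset.mem_coe, Finsupp.mem_support_iff]
  by_cases hj : j ∈ Set.range e
  · obtain ⟨i, rfl⟩ := hj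
    simp [shiftExponent_apply_self]
  · simp [shiftExponent_apply_of_notMem e c hj, hj]

/-- Lowering by one each exponent of a variable in the range of `e`. -/
def unshiftExponent (e : Fin k ↪ Fin n) (u : Fin n →₀ ℕ) : Fin k →₀ ℕ :=
  Finsupp.equivFunOnFinite.symm fun i => u (e i) - 1

theorem unshiftExponent_shiftExponent (e : Fin k ↪ Fin n) (c : Fin k →₀ ℕ) :
    unshiftExponent e (shiftExponent e c) = c := by
  ext i
  simp [unshiftExponent, shiftExponent_apply_self]

theorem shiftExponent_unshiftExponent (e : Fin k ↪ Fin n) (u : Fin n →₀ ℕ)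
    (hu : (u.support : Set (Fin n)) = Set.range e) :
    shiftExponent e (unshiftExponent e u) = u := by
  ext j
  by_cases hj : j ∈ Set.range e
  -- Exponents on the range are positive, so the truncated subtraction of `1` can be undone.
  · have h0 : u j ≠ 0 := by
      rw [← hu] at hj
      exact Finsupp.mem_support_iff.mp hj
    obtain ⟨i, rfl⟩ := hj
    rw [shiftExponent_apply_self]
    simp only [unshiftExponent, Finsupp.coe_equivFunOnFinite_symm]
    omega
  · rw [shiftExponent_apply_of_notMem e _ hj]
    rw [← hu] at hj
    exact (Finsupp.notMem_support_iff.mp hj).symm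

theorem degree_shiftExponent (e : Fin k ↪ Fin n) (c : Fin k →₀ ℕ) :
    (shiftExponent e c).degree = k + c.degree := by
  rw [shiftExponent, map_add, map_sum, Finsupp.degree_mapDomain]
  simp

/-- The map `f ↦ x_S f` placing a polynomial in the variables indexed by the range `S` of `e`. -/
def supportEmb (e : Fin k ↪ Fin n) : MvPolynomial (Fin k) ℝ →ₗ[ℝ] MvPolynomial (Fin n) ℝ :=
  LinearMap.mulLeft ℝ (∏ i, X (e i)) ∘ₗ (rename e).toLinearMap

theorem supportEmb_apply (e : Fin k ↪ Fin n) (f : MvPolynomial (Fin k) ℝ) :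
    supportEmb e f = (∏ i, X (e i)) * rename e f := rfl

theorem supportEmb_monomial (e : Fin k ↪ Fin n) (c : Fin k →₀ ℕ) (r : ℝ) :
    supportEmb e (monomial c r) = monomial (shiftExponent e c) r := by
  have h : ∏ i, (X (e i) : MvPolynomial (Fin n) ℝ) =
      monomial (∑ i, Finsupp.single (e i) 1) 1 := by
    rw [monomial_sum_one]
    rfl
  rw [supportEmb_apply, h, rename_monomial, monomial_mul, one_mul, shiftExponent]

open Classical in
/-- The projection to the monomials whose support is the range of `e`, followed by division by
`x_S`. -/
def supportProj (e : Fin k ↪ Fin n) : MvPolynomial (Fin n) ℝ →ₗ[ℝ] MvPolynomial (Fin k) ℝ :=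
  (basisMonomials (Fin n) ℝ).constr ℝ fun u =>
    if (u.support : Set (Fin n)) = Set.range e then monomial (unshiftExponent e u) 1 else 0

theorem supportProj_monomial (e : Fin k ↪ Fin n) (u : Fin n →₀ ℕ) (r : ℝ)
    (hu : (u.support : Set (Fin n)) = Set.range e) :
    supportProj e (monomial u r) = monomial (unshiftExponent e u) r := by
  have h : (monomial u r : MvPolynomial (Fin n) ℝ) = r • basisMonomials (Fin n) ℝ u := by
    simp [smul_monomial]
  rw [h, map_smul, supportProj, Module.Basis.constr_basis, if_pos hu, smul_monomial, smul_eq_mul,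
    mul_one]

theorem supportProj_monomial_eq_zero (e : Fin k ↪ Fin n) (u : Fin n →₀ ℕ) (r : ℝ)
    (hu : (u.support : Set (Fin n)) ≠ Set.range e) :
    supportProj e (monomial u r) = 0 := by
  have h : (monomial u r : MvPolynomial (Fin n) ℝ) = r • basisMonomials (Fin n) ℝ u := by
    simp [smul_monomial]
  rw [h, map_smul, supportProj, Module.Basis.constr_basis, if_neg hu, smul_zero]

theorem supportProj_supportEmb (e : Fin k ↪ Fin n) (f : MvPolynomial (Fin k) ℝ) :
    supportProj e (supportEmb e f) = f := by
  induction f using MvPolynomial.induction_on' with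
  | monomial c r =>
    rw [supportEmb_monomial, supportProj_monomial _ _ _ (support_shiftExponent e c),
      unshiftExponent_shiftExponent]
  | add p q hp hq => rw [map_add, map_add, hp, hq]

theorem supportProj_supportEmb_of_range_ne (e : Fin k ↪ Fin n) (e' : Fin l ↪ Fin n)
    (h : Set.range e' ≠ Set.range e) (f : MvPolynomial (Fin l) ℝ) :
    supportProj e (supportEmb e' f) = 0 := by
  induction f using MvPolynomial.induction_on' with
  | monomial c r =>
    rw [supportEmb_monomial, supportProj_monomial_eq_zero]
    rwa [support_shiftExponent]
  | add p q hp hq => rw [map_add, map_add, hp, hq, add_zero]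

/-- Each monomial has exactly one support, so exactly one `S` returns it and the others kill it. -/
theorem sum_supportEmb_supportProj (f : MvPolynomial (Fin n) ℝ) :
    ∑ S : Finset (Fin n), supportEmb (S.orderEmbOfFin rfl).toEmbedding
      (supportProj (S.orderEmbOfFin rfl).toEmbedding f) = f := by
  have hr : ∀ S : Finset (Fin n), Set.range (S.orderEmbOfFin rfl).toEmbedding = S := fun S =>
    S.range_orderEmbOfFin rfl
  induction f using MvPolynomial.induction_on' with
  | monomial u r =>
    rw [Finset.sum_eq_single u.support]
    · rw [supportProj_monomial _ _ _ (hr _).symm, supportEmb_monomial,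
        shiftExponent_unshiftExponent _ _ (hr _).symm]
    · intro S _ hS
      rw [supportProj_monomial_eq_zero, map_zero]
      rw [hr]
      exact fun h => hS (Finset.coe_injective h).symm
    · simp
  | add p q hp hq => simp only [map_add, Finset.sum_add_distrib, hp, hq]

theorem rename_supportEmb (σ : Equiv.Perm (Fin n)) (e : Fin k ↪ Fin n)
    (f : MvPolynomial (Fin k) ℝ) :
    rename σ (supportEmb e f) = supportEmb (e.trans σ.toEmbedding) f := by
  rw [supportEmb_apply, supportEmb_apply, map_mul, map_prod, rename_rename]
  simp only [rename_X]
  rfl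

theorem supportEmb_rename (τ : Equiv.Perm (Fin k)) (e : Fin k ↪ Fin n)
    (f : MvPolynomial (Fin k) ℝ) :
    supportEmb e (rename τ f) = supportEmb (τ.toEmbedding.trans e) f := by
  rw [supportEmb_apply, supportEmb_apply, rename_rename]
  congr 1
  exact (Equiv.prod_comp τ fun i => (X (e i) : MvPolynomial (Fin n) ℝ)).symm

theorem isHomogeneous_supportEmb (e : Fin k ↪ Fin n) {f : MvPolynomial (Fin k) ℝ} {d : ℕ}
    (hf : f.IsHomogeneous d) : (supportEmb e f).IsHomogeneous (k + d) := by
  rw [supportEmb_apply]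
  refine IsHomogeneous.mul ?_ hf.rename_isHomogeneous
  have := IsHomogeneous.prod Finset.univ (fun i => (X (e i) : MvPolynomial (Fin n) ℝ))
    (fun _ => 1) fun i _ => isHomogeneous_X ℝ (e i)
  simpa using this

/-- Dividing by `x_S` lowers the degree by `k`. An arbitrary `p` serves two uses: homogeneous
polynomials, and `⊥`, which gives vanishing when `d < k`. -/
theorem supportProj_mem {p : Submodule ℝ (MvPolynomial (Fin k) ℝ)} (e : Fin k ↪ Fin n)
    {f : MvPolynomial (Fin n) ℝ} {d : ℕ} (hf : f.IsHomogeneous d)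
    (hp : ∀ c : Fin k →₀ ℕ, ∀ r : ℝ, k + c.degree = d → monomial c r ∈ p) :
    supportProj e f ∈ p := by
  rw [← f.support_sum_monomial_coeff, map_sum]
  refine Submodule.sum_mem _ fun u hu => ?_
  by_cases h : (u.support : Set (Fin n)) = Set.range e
  · rw [supportProj_monomial _ _ _ h]
    refine hp _ _ ?_
    rw [← degree_shiftExponent e, shiftExponent_unshiftExponent e u h]
    have := hf (mem_support_iff.mp hu)
    rwa [Finsupp.degree_eq_weight_one]
  · rw [supportProj_monomial_eq_zero _ _ _ h]
    exact Submodule.zero_mem _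

theorem isHomogeneous_supportProj (e : Fin k ↪ Fin n) {f : MvPolynomial (Fin n) ℝ} {d : ℕ}
    (hf : f.IsHomogeneous d) : (supportProj e f).IsHomogeneous (d - k) :=
  supportProj_mem (p := homogeneousSubmodule (Fin k) ℝ (d - k)) e hf fun _ r hc =>
    isHomogeneous_monomial r (by omega)

theorem supportProj_eq_zero (e : Fin k ↪ Fin n) {f : MvPolynomial (Fin n) ℝ} {d : ℕ}
    (hf : f.IsHomogeneous d) (hd : d < k) : supportProj e f = 0 :=
  (Submodule.mem_bot ℝ).mp <| supportProj_mem e hf fun _ _ hc => by omega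

/-! ### Multiplication by `x_S` intertwines `D̂_m` and `D̃_m`. -/

theorem partialPow_succ (i : Fin n) (m : ℕ) (f : MvPolynomial (Fin n) ℝ) :
    partialPow i (m + 1) f = partialPow i m (pderiv i f) := by
  simp [partialPow, pow_succ]

theorem partialPow_rename_embedding (e : Fin k ↪ Fin n) (i : Fin k) (m : ℕ)
    (f : MvPolynomial (Fin k) ℝ) :
    partialPow (e i) m (rename e f) = rename e (partialPow i m f) := by
  induction m generalizing f with
  | zero => simp [partialPow]
  | succ m ih => rw [partialPow_succ, partialPow_succ, pderiv_rename e.injective, ih]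

theorem partialPow_mul_of_pderiv_eq_zero (i : Fin n) (m : ℕ) {q : MvPolynomial (Fin n) ℝ}
    (hq : pderiv i q = 0) (f : MvPolynomial (Fin n) ℝ) :
    partialPow i m (q * f) = q * partialPow i m f := by
  induction m generalizing f with
  | zero => simp [partialPow]
  | succ m ih => rw [partialPow_succ, partialPow_succ, pderiv_mul, hq, zero_mul, zero_add, ih]

theorem pderiv_prod_X_eq_zero {ι : Type*} (j : Fin n) (s : Finset ι) (g : ι → Fin n)
    (h : ∀ i ∈ s, g i ≠ j) : pderiv j (∏ i ∈ s, (X (g i) : MvPolynomial (Fin n) ℝ)) = 0 := by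
  classical
  induction s using Finset.induction_on with
  | empty => simp
  | insert a s ha ih =>
    rw [Finset.prod_insert ha, pderiv_mul, ih fun i hi => h i (Finset.mem_insert_of_mem hi),
      pderiv_X_of_ne (h a (Finset.mem_insert_self a s)), zero_mul, mul_zero, add_zero]

theorem pderiv_rename_of_notMem_range (e : Fin k ↪ Fin n) {j : Fin n} (hj : j ∉ Set.range e)
    (f : MvPolynomial (Fin k) ℝ) : pderiv j (rename e f) = 0 := by
  classical
  refine pderiv_eq_zero_of_notMem_vars fun h => hj ?_
  obtain ⟨i, _, hi⟩ := Finset.mem_image.mp (vars_rename e f h)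
  exact ⟨i, hi⟩

/-- `D̃_m (x_S f) = x_S (D̂_m f)` for `f` in the variables indexed by `S`. -/
theorem tildeOp_supportEmb (m : ℕ) (e : Fin k ↪ Fin n) (f : MvPolynomial (Fin k) ℝ) :
    tildeOp n m (supportEmb e f) = supportEmb e (hatOp k m f) := by
  simp only [tildeOp, hatOp, LinearMap.sum_apply, LinearMap.comp_apply,
    LinearMap.mulLeft_apply, map_sum]
  symm
  -- Terms with `j` outside the range vanish, since `x_S f` does not involve `x_j`.
  refine Fintype.sum_of_injective e e.injective _ _ (fun j hj => ?_) fun i => ?_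
  · rw [partialPow_succ, supportEmb_apply, pderiv_mul, pderiv_rename_of_notMem_range e hj,
      pderiv_prod_X_eq_zero j _ _ fun i _ h => hj ⟨i, h⟩, zero_mul, mul_zero, add_zero, map_zero,
      mul_zero]
  -- Only the factor `x_i` of `x_S` interacts with `∂_i`: it is moved next to `f`, and the outer
  -- `x_i` of `D̃_m` restores `x_S`.
  · have hX : ∏ j, (X (e j) : MvPolynomial (Fin n) ℝ) =
        (∏ j ∈ Finset.univ.erase i, X (e j)) * X (e i) :=
      (Finset.prod_erase_mul _ _ (Finset.mem_univ i)).symm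
    have hf : supportEmb e f = (∏ j ∈ Finset.univ.erase i, X (e j)) * rename e (X i * f) := by
      rw [supportEmb_apply, hX, map_mul, rename_X, mul_assoc]
    rw [hf, partialPow_mul_of_pderiv_eq_zero (e i), partialPow_rename_embedding, supportEmb_apply, hX]
    · ring
    · exact pderiv_prod_X_eq_zero _ _ _ fun j hj h => (Finset.ne_of_mem_erase hj) (e.injective h)

theorem supportEmb_mem_tildeHarmonics {a : ℕ → ℝ} (e : Fin k ↪ Fin n)
    {f : MvPolynomial (Fin k) ℝ} (hf : f ∈ (hatHarmonics a k).toSubmodule) :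
    supportEmb e f ∈ (tildeHarmonics a n).toSubmodule := fun m hm => by
  rw [tildeOp_supportEmb, ← map_smul, hf m hm, map_zero]

/-- Decompose `f` by supports: `D̃_m` keeps every component in its summand, so the `S`-component of
`a_m D̃_m f = 0` is the hat equation. -/
theorem supportProj_mem_hatHarmonics {a : ℕ → ℝ} (S : Finset (Fin n))
    {f : MvPolynomial (Fin n) ℝ} (hf : f ∈ (tildeHarmonics a n).toSubmodule) :
    supportProj (S.orderEmbOfFin rfl).toEmbedding f ∈ (hatHarmonics a S.card).toSubmodule := by
  intro m hm
  have h : supportProj (S.orderEmbOfFin rfl).toEmbedding (a m • tildeOp n m f) = 0 := by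
    rw [hf m hm, map_zero]
  rw [← sum_supportEmb_supportProj f] at h
  simp only [map_sum, tildeOp_supportEmb, map_smul] at h
  rw [Finset.sum_eq_single S, supportProj_supportEmb] at h
  · exact h
  · intro T _ hT
    refine supportProj_supportEmb_of_range_ne _ _ (fun h => hT ?_) _
    have h' : Set.range (T.orderEmbOfFin rfl) = Set.range (S.orderEmbOfFin rfl) := h
    rw [Finset.range_orderEmbOfFin, Finset.range_orderEmbOfFin] at h'
    exact Finset.coe_injective h'
  · simp

end SupportDecomposition

/-! ### Characters of the graded pieces -/

/-- Write `T = ∑ (T ∘ emb i) ∘ proj i` and use `tr (AB) = tr (BA)`; independence of the summands is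
not needed. -/
theorem trace_eq_sum_of_sum_comp_eq_id {ι V : Type*} {U : ι → Type*} [AddCommGroup V] [Module ℝ V]
    [Module.Finite ℝ V] [∀ i, AddCommGroup (U i)] [∀ i, Module ℝ (U i)]
    [∀ i, Module.Finite ℝ (U i)] (s : Finset ι) (emb : ∀ i, U i →ₗ[ℝ] V)
    (proj : ∀ i, V →ₗ[ℝ] U i) (h : ∀ v, ∑ i ∈ s, emb i (proj i v) = v) (T : V →ₗ[ℝ] V) :
    LinearMap.trace ℝ V T = ∑ i ∈ s, LinearMap.trace ℝ (U i) (proj i ∘ₗ T ∘ₗ emb i) := by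
  have hT : T = ∑ i ∈ s, (T ∘ₗ emb i) ∘ₗ proj i := by
    ext v
    rw [LinearMap.sum_apply]
    conv_lhs => rw [← h v, map_sum]
    rfl
  conv_lhs => rw [hT, map_sum]
  exact Finset.sum_congr rfl fun i _ => LinearMap.trace_comp_comm' _ _

instance finite_gradedPiece {n : ℕ} (V : Subrepresentation (permRep n)) (d : ℕ) :
    Module.Finite ℝ (gradedPiece V d).toSubmodule := by
  have : Module.Finite ℝ (homogeneousSubmodule (Fin n) ℝ d) :=
    Module.Finite.iff_fg.mpr (homogeneousSubmodule_fg (Fin n) ℝ d)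
  have hle : (gradedPiece V d).toSubmodule ≤ homogeneousSubmodule (Fin n) ℝ d := inf_le_right
  exact Module.Finite.of_injective (Submodule.inclusion hle) (Submodule.inclusion_injective hle)

section Character

variable {n : ℕ} (a : ℕ → ℝ)

/-- The map `f ↦ x_S f` from hat-harmonics to tilde-harmonics, in degrees `d - |S|` and `d`. -/
def harmonicEmb (d : ℕ) (S : {S : Finset (Fin n) // S.card ≤ d}) :
    (gradedPiece (hatHarmonics a S.1.card) (d - S.1.card)).toSubmodule →ₗ[ℝ]
      (gradedPiece (tildeHarmonics a n) d).toSubmodule :=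
  (supportEmb (S.1.orderEmbOfFin rfl).toEmbedding).restrict fun f hf =>
    ⟨supportEmb_mem_tildeHarmonics _ hf.1, by
      have h := isHomogeneous_supportEmb (S.1.orderEmbOfFin rfl).toEmbedding hf.2
      rwa [Nat.add_sub_cancel' S.2] at h⟩

/-- The projection from tilde-harmonics to hat-harmonics indexed by `S`. -/
def harmonicProj (d : ℕ) (S : {S : Finset (Fin n) // S.card ≤ d}) :
    (gradedPiece (tildeHarmonics a n) d).toSubmodule →ₗ[ℝ]
      (gradedPiece (hatHarmonics a S.1.card) (d - S.1.card)).toSubmodule :=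
  (supportProj (S.1.orderEmbOfFin rfl).toEmbedding).restrict fun _ hf =>
    ⟨supportProj_mem_hatHarmonics S.1 hf.1, isHomogeneous_supportProj _ hf.2⟩

theorem sum_harmonicEmb_harmonicProj (d : ℕ)
    (f : (gradedPiece (tildeHarmonics a n) d).toSubmodule) :
    ∑ S, harmonicEmb a d S (harmonicProj a d S f) = f := by
  apply Subtype.ext
  rw [AddSubmonoidClass.coe_finsetSum]
  refine Eq.trans ?_ (sum_supportEmb_supportProj f.1)
  refine Fintype.sum_of_injective Subtype.val Subtype.val_injective _ _ (fun S hS => ?_)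
    fun S => rfl
  -- Sets with more than `d` elements contribute nothing in degree `d`; for the others `d - |S|` is
  -- not truncated.
  rw [supportProj_eq_zero _ f.2.2, map_zero]
  by_contra hlt
  exact hS ⟨⟨S, not_lt.mp hlt⟩, rfl⟩

/-- The contribution of the monomials with support `S` to the character of a tilde-harmonic
space. -/
def supportTrace (d : ℕ) (S : {S : Finset (Fin n) // S.card ≤ d}) (σ : Equiv.Perm (Fin n)) : ℝ :=
  LinearMap.trace ℝ _ (harmonicProj a d S ∘ₗ
    (gradedPiece (tildeHarmonics a n) d).toRepresentation σ ∘ₗ harmonicEmb a d S)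

theorem character_tildeHarmonics (d : ℕ) (σ : Equiv.Perm (Fin n)) :
    (gradedPiece (tildeHarmonics a n) d).toRepresentation.character σ =
      ∑ S, supportTrace a d S σ :=
  trace_eq_sum_of_sum_comp_eq_id Finset.univ (harmonicEmb a d) (harmonicProj a d)
    (sum_harmonicEmb_harmonicProj a d) _

/-- Here `σ` moves the `S`-summand to that of `σ(S) ≠ S`, which the projection to `S` kills. -/
theorem supportTrace_eq_zero (d : ℕ) (S : {S : Finset (Fin n) // S.card ≤ d})
    (σ : Equiv.Perm (Fin n)) (h : ¬ ∀ i ∈ S.1, σ i ∈ S.1) : supportTrace a d S σ = 0 := by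
  have : harmonicProj a d S ∘ₗ (gradedPiece (tildeHarmonics a n) d).toRepresentation σ ∘ₗ
      harmonicEmb a d S = 0 := by
    refine LinearMap.ext fun f => Subtype.ext ?_
    change supportProj _ (rename σ (supportEmb _ f.1)) = 0
    rw [rename_supportEmb]
    refine supportProj_supportEmb_of_range_ne _ _ (fun hr => h fun i hi => ?_) _
    have hS : Set.range (S.1.orderEmbOfFin rfl).toEmbedding = S.1 := S.1.range_orderEmbOfFin rfl
    rw [hS] at hr
    rw [← Finset.mem_coe, ← hS] at hi
    obtain ⟨j, rfl⟩ := hi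
    rw [← Finset.mem_coe, ← hr]
    exact ⟨j, rfl⟩
  rw [supportTrace, this, map_zero]

/-- `τ` is the restriction of `σ` to `S`, read through the increasing enumeration of `S`; it
permutes the factors of `x_S`, so `x_S` is fixed. -/
theorem supportTrace_eq_character (d : ℕ) (S : {S : Finset (Fin n) // S.card ≤ d})
    (σ : Equiv.Perm (Fin n)) (τ : Equiv.Perm (Fin S.1.card))
    (h : ∀ i, σ (S.1.orderEmbOfFin rfl i) = S.1.orderEmbOfFin rfl (τ i)) :
    supportTrace a d S σ =
      (gradedPiece (hatHarmonics a S.1.card) (d - S.1.card)).toRepresentation.character τ := by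
  rw [supportTrace, Representation.character]
  congr 1
  refine LinearMap.ext fun f => Subtype.ext ?_
  change supportProj _ (rename σ (supportEmb _ f.1)) = rename τ f.1
  rw [rename_supportEmb]
  have he : (S.1.orderEmbOfFin rfl).toEmbedding.trans σ.toEmbedding =
      τ.toEmbedding.trans (S.1.orderEmbOfFin rfl).toEmbedding := by
    ext1 i
    exact h i
  rw [he, ← supportEmb_rename, supportProj_supportEmb]

theorem sum_supportTrace_smul (d : ℕ) (S : {S : Finset (Fin n) // S.card ≤ d}) :
    ∑ σ : Equiv.Perm (Fin n), supportTrace a d S σ • cyclePowerSum σ =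
      (∑ τ : Equiv.Perm (Fin S.1.card),
        (gradedPiece (hatHarmonics a S.1.card) (d - S.1.card)).toRepresentation.character τ •
          cyclePowerSum τ) * ∑ ρ : Equiv.Perm (Fin (n - S.1.card)), cyclePowerSum ρ := by
  have hc : S.1ᶜ.card = n - S.1.card := by rw [Finset.card_compl, Fintype.card_fin]
  let E := finSumEquivOfFinset (s := S.1) rfl hc
  have hE : ∀ i, E (Sum.inl i) = S.1.orderEmbOfFin rfl i := fun i => rfl
  rw [Finset.sum_mul_sum, ← Fintype.sum_prod_type']
  symm
  refine Fintype.sum_of_injective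
    (fun p : Equiv.Perm (Fin S.1.card) × Equiv.Perm (Fin (n - S.1.card)) =>
      E.permCongr (Equiv.sumCongr p.1 p.2))
    (E.permCongr.injective.comp Equiv.Perm.sumCongrHom_injective) _ _ (fun σ hσ => ?_) fun p => ?_
  · rw [supportTrace_eq_zero, zero_smul]
    intro hS
    -- By finiteness, a permutation mapping `S` into itself also preserves the complement, hence
    -- splits as a pair `(τ, ρ)`.
    have hmem : E.symm.permCongr σ ∈ (Equiv.Perm.sumCongrHom (Fin S.1.card)
        (Fin (n - S.1.card))).range := by
      refine Equiv.Perm.mem_sumCongrHom_range_of_perm_mapsTo_inl ?_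
      rintro _ ⟨i, rfl⟩
      have hi := hS _ (S.1.orderEmbOfFin_mem rfl i)
      rw [← Finset.mem_coe, ← S.1.range_orderEmbOfFin rfl] at hi
      obtain ⟨j, hj⟩ := hi
      refine ⟨j, ?_⟩
      rw [Equiv.permCongr_apply, Equiv.symm_symm, Equiv.eq_symm_apply, hE, hE, hj]
    obtain ⟨p, hp⟩ := hmem
    refine hσ ⟨p, ?_⟩
    change E.permCongr (Equiv.Perm.sumCongrHom _ _ p) = σ
    rw [hp]
    ext x
    simp
  · rw [cyclePowerSum_permCongr_sumCongr, smul_mul_assoc,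
      supportTrace_eq_character a d S _ p.1 fun i => ?_]
    rw [Equiv.permCongr_apply, ← hE, Equiv.symm_apply_apply]
    rfl

end Character

theorem sum_subtype_card_le {M : Type*} [AddCommMonoid M] {n : ℕ} (d : ℕ)
    (g : ℕ → M) :
    ∑ S : {S : Finset (Fin n) // S.card ≤ d}, g S.1.card =
      ∑ k ∈ Finset.range (n + 1), n.choose k • if k ≤ d then g k else 0 := by
  have h := Finset.sum_powerset_apply_card (fun k => if k ≤ d then g k else 0)
    (x := (Finset.univ : Finset (Fin n)))
  rw [Finset.powerset_univ, Finset.card_univ, Fintype.card_fin] at h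
  rw [← h]
  refine Fintype.sum_of_injective Subtype.val Subtype.val_injective _ _ (fun S hS => ?_)
    fun S => (if_pos S.2).symm
  exact if_neg fun hle => hS ⟨⟨S, hle⟩, rfl⟩

/-- Dimensions are the values of the characters at the identity, which stabilizes every `S`. -/
theorem finrank_tildeHarmonics (a : ℕ → ℝ) (n d : ℕ) :
    Module.finrank ℝ (gradedPiece (tildeHarmonics a n) d).toSubmodule =
      ∑ S : {S : Finset (Fin n) // S.card ≤ d},
        Module.finrank ℝ (gradedPiece (hatHarmonics a S.1.card) (d - S.1.card)).toSubmodule := by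
  have h := character_tildeHarmonics (n := n) a d 1
  simp only [fun S => supportTrace_eq_character a d S (1 : Equiv.Perm (Fin n)) 1 fun i => rfl,
    Representation.char_one] at h
  exact_mod_cast h

/-! ### The Frobenius characteristic and the Hilbert series -/

theorem frobeniusChar_tildeHarmonics (a : ℕ → ℝ) (n : ℕ) :
    frobeniusChar (tildeHarmonics a n) =
      ∑ k ∈ Finset.range (n + 1), (PowerSeries.X : PowerSeries SymFun) ^ k *
        frobeniusChar (hatHarmonics a k) * PowerSeries.C (completeSym (n - k)) := by
  ext1 d
  rw [map_sum, frobeniusChar, PowerSeries.coeff_mk]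
  simp only [character_tildeHarmonics, Finset.sum_smul]
  rw [Finset.sum_comm]
  simp only [sum_supportTrace_smul]
  rw [sum_subtype_card_le d fun k => (∑ τ : Equiv.Perm (Fin k),
      (gradedPiece (hatHarmonics a k) (d - k)).toRepresentation.character τ •
        cyclePowerSum τ) * ∑ ρ : Equiv.Perm (Fin (n - k)), cyclePowerSum ρ, Finset.smul_sum]
  refine Finset.sum_congr rfl fun k hk => ?_
  have hkn : k ≤ n := Nat.lt_succ_iff.mp (Finset.mem_range.mp hk)
  rw [PowerSeries.coeff_mul_C, PowerSeries.coeff_X_pow_mul']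
  split_ifs with hkd
  · rw [frobeniusChar, PowerSeries.coeff_mk, completeSym_eq_sum, smul_mul_smul_comm,
      ← Nat.cast_smul_eq_nsmul ℝ, smul_smul]
    congr 1
    -- What remains is `C(n,k) / n! = 1 / (k! (n-k)!)`.
    rw [Nat.cast_choose ℝ hkn]
    have h1 : (n.factorial : ℝ) ≠ 0 := Nat.cast_ne_zero.mpr n.factorial_ne_zero
    field_simp
  · rw [smul_zero, smul_zero, zero_mul]

theorem hilbertSeries_tildeHarmonics (a : ℕ → ℝ) (n : ℕ) :
    hilbertSeries (tildeHarmonics a n) =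
      ∑ k ∈ Finset.range (n + 1), (n.choose k : PowerSeries ℤ) *
        (PowerSeries.X : PowerSeries ℤ) ^ k * hilbertSeries (hatHarmonics a k) := by
  ext1 d
  rw [map_sum, hilbertSeries, PowerSeries.coeff_mk, finrank_tildeHarmonics,
    sum_subtype_card_le d fun k =>
      Module.finrank ℝ (gradedPiece (hatHarmonics a k) (d - k)).toSubmodule, Nat.cast_sum]
  refine Finset.sum_congr rfl fun k _ => ?_
  rw [mul_assoc, ← nsmul_eq_mul, map_nsmul, PowerSeries.coeff_X_pow_mul']
  split_ifs with hkd
  · rw [hilbertSeries, PowerSeries.coeff_mk, smul_eq_mul, Nat.cast_mul, ← nsmul_eq_mul]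
  · simp

end SteenrodHarmonics

end

theorem mainTheorem4 (a : ℕ → ℝ) (ha : ∀ k : ℕ, 1 ≤ k → a k = 0 ∨ a k = 1) (n : ℕ) :
    (SteenrodHarmonics.frobeniusChar (SteenrodHarmonics.tildeHarmonics a n) =
      ∑ k ∈ Finset.range (n + 1),
        (PowerSeries.X : PowerSeries SteenrodHarmonics.SymFun) ^ k *
          SteenrodHarmonics.frobeniusChar (SteenrodHarmonics.hatHarmonics a k) *
          PowerSeries.C (SteenrodHarmonics.completeSym (n - k))) ∧
    (SteenrodHarmonics.hilbertSeries (SteenrodHarmonics.tildeHarmonics a n) =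
      ∑ k ∈ Finset.range (n + 1),
        (n.choose k : PowerSeries ℤ) * (PowerSeries.X : PowerSeries ℤ) ^ k *
          SteenrodHarmonics.hilbertSeries (SteenrodHarmonics.hatHarmonics a k)) := by
  exact ⟨SteenrodHarmonics.frobeniusChar_tildeHarmonics a n,
    SteenrodHarmonics.hilbertSeries_tildeHarmonics a n⟩
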